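/- **Conventions.** Let $(X,d)$ be a geodesic metric space (not necessarily proper) with an isometric action of a group $G$, and let $o\in X$. - For $Y\subseteq X$ and $x\in X$ let $\pi_Y(x)=\{y\in Y: d(x,y)\le d(x,Y)+1\}$ be the (coarse) closest point projection, and $\pi_Y(A)=\bigcup_{x\in A}\pi_Y(x)$. A subset $Y\subseteq X$ is *contracting* if there is $C\ge 0$ such that $\operatorname{diam}\pi_Y(\alpha)\le C$ for every geodesic segment $\alpha$ with $d(\alpha,Y)\ge C$. - An element $g\in G$ is *contracting* if $\langle g\rangle o$ is a contracting subset and $\mathbb Z\to X$, $n\mapsto g^n o$, is a quasi-isometric embedding. Two contracting elements $g,h$ are *weakly independent* if there is a function $\mathcal R:[0,\infty)\to[0,\infty)$ with $\operatorname{diam}\big(N_r(\langle g\rangle o)\cap N_r(\langle h\rangle o)\big)\le\mathcal R(r)$ for all $r\ge 0$, where $N_r$ is the closed $r$-neighbourhood. The action has the *contracting property* if $G$ contains two weakly independent contracting elements. (None of this depends on $o$.) - The *stable translation length* of $g\in G$ is $\ell_d(g)=\lim_{n\to\infty} d(o,g^n o)/n$ (it does not depend on $o$). - A subgroup $H\le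 G$ is *unbounded* in $X$ if every $H$-orbit is an unbounded subset of $X$. **Statement.** Suppose that a group $G$ acts isometrically on two geodesic metric spaces $(X_1,d_1)$ and $(X_2,d_2)$, both actions having the contracting property. Let $n\ge 0$ and let $H_n\lhd H_{n-1}\lhd\cdots\lhd H_1\lhd H_0=G$ be a subnormal sequence of subgroups, each of which is unbounded in $X_1$ or in $X_2$. Then $G$ has marked length spectrum (MLS) rigidity from $H_n$: if $\ell_{d_1}(g)=\ell_{d_2}(g)$ for all $g\in H_n$, then for all basepoints $o_1\in X_1$, $o_2\in X_2$, $$\sup_{g,h\in G}\big|d_1(go_1,ho_1)-d_2(go_2,ho_2)\big|<+\infty,$$ that is, the orbit map $Go_1\to Go_2$, $go_1\mapsto go_2$, is well defined up to a bounded error and is a rough isometry. -/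

import Mathlib

open Filter Topology
open scoped NNReal

namespace MLS

/-- The path `α`, restricted to `[0, L]`, is a geodesic segment of length `L`. -/
def IsGeodesicSegment {X : Type*} [MetricSpace X] (L : ℝ) (α : ℝ → X) : Prop :=
  0 ≤ L ∧ ∀ s ∈ Set.Icc (0 : ℝ) L, ∀ t ∈ Set.Icc (0 : ℝ) L, dist (α s) (α t) = |s - t|

/-- A geodesic metric space: any two points are joined by a geodesic segment. -/
def IsGeodesicSpace (X : Type*) [MetricSpace X] : Prop :=
  ∀ x y : X, ∃ (L : ℝ) (α : ℝ → X), IsGeodesicSegment L α ∧ α 0 = x ∧ α L = y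

/-- The closest point projection of the point `x` to `Y`. The space is not assumed to be proper,
so closest points need not exist and the projection is the coarse one: all points of `Y` whose
distance to `x` is within `1` of the infimum. -/
def proj {X : Type*} [MetricSpace X] (Y : Set X) (x : X) : Set X :=
  {y | y ∈ Y ∧ dist x y ≤ Metric.infDist x Y + 1}

/-- The projection of a subset `A` to `Y`. -/
def projSet {X : Type*} [MetricSpace X] (Y A : Set X) : Set X :=
  ⋃ x ∈ A, proj Y x

/-- `Y` is `C`-contracting: every geodesic segment at distance at least `C` from `Y` has
projection to `Y` of diameter at most `C`. (Distance and diameter bounds are written out pointwise,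
so that nothing depends on the value of the infimum or supremum of a bad set.) -/
def IsContractingWith {X : Type*} [MetricSpace X] (C : ℝ) (Y : Set X) : Prop :=
  ∀ (L : ℝ) (α : ℝ → X), IsGeodesicSegment L α →
    (∀ x ∈ α '' Set.Icc 0 L, ∀ y ∈ Y, C ≤ dist x y) →
    ∀ p ∈ projSet Y (α '' Set.Icc 0 L), ∀ q ∈ projSet Y (α '' Set.Icc 0 L), dist p q ≤ C

/-- A contracting subset. -/
def IsContractingSet {X : Type*} [MetricSpace X] (Y : Set X) : Prop :=
  ∃ C : ℝ, 0 ≤ C ∧ IsContractingWith C Y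

/-- A quasi-isometric embedding, for some constants `l ≥ 1` and `c ≥ 0`. -/
def IsQuasiIsometricEmbedding {A B : Type*} [MetricSpace A] [MetricSpace B] (f : A → B) : Prop :=
  ∃ l c : ℝ, 1 ≤ l ∧ 0 ≤ c ∧ ∀ a b : A,
    1 / l * dist a b - c ≤ dist (f a) (f b) ∧ dist (f a) (f b) ≤ l * dist a b + c

/-- `Y` and `Z` have `R`-bounded intersection: for all `r ≥ 0`, the intersection of the closed
`r`-neighbourhoods of `Y` and `Z` has diameter at most `R r`. -/
def HasBoundedIntersection {X : Type*} [MetricSpace X] (R : ℝ≥0 → ℝ≥0) (Y Z : Set X) : Prop :=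
  ∀ r : ℝ≥0, ∀ x ∈ Metric.cthickening (r : ℝ) Y ∩ Metric.cthickening (r : ℝ) Z,
    ∀ y ∈ Metric.cthickening (r : ℝ) Y ∩ Metric.cthickening (r : ℝ) Z, dist x y ≤ (R r : ℝ)

/-- The orbit `⟨g⟩ · o` of the cyclic subgroup generated by `g`. -/
def cyclicOrbit {G X : Type*} [Group G] [MulAction G X] (o : X) (g : G) : Set X :=
  MulAction.orbit (Subgroup.zpowers g) o

/-- `g` is a contracting element (with respect to the basepoint `o`). -/
def IsContractingElement {G X : Type*} [Group G] [MetricSpace X] [MulAction G X]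
    (o : X) (g : G) : Prop :=
  IsContractingSet (cyclicOrbit o g) ∧ IsQuasiIsometricEmbedding (fun n : ℤ => g ^ n • o)

/-- `g` and `h` are weakly independent (with respect to the basepoint `o`). -/
def WeaklyIndependent {G X : Type*} [Group G] [MetricSpace X] [MulAction G X]
    (o : X) (g h : G) : Prop :=
  ∃ R : ℝ≥0 → ℝ≥0, HasBoundedIntersection R (cyclicOrbit o g) (cyclicOrbit o h)

/-- The action of `G` on `X` has contracting property: for some basepoint, there are two weakly
independent contracting elements. (For isometric actions on geodesic spaces the choice of the
basepoint does not matter.) -/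
def HasContractingProperty (G X : Type*) [Group G] [MetricSpace X] [MulAction G X] : Prop :=
  ∃ (o : X) (g h : G),
    IsContractingElement o g ∧ IsContractingElement o h ∧ WeaklyIndependent o g h

/-- The subgroup `H` is unbounded in `X`: every `H`-orbit is an unbounded subset. -/
def IsUnboundedIn {G : Type*} [Group G] (H : Subgroup G) (X : Type*) [MetricSpace X]
    [MulAction G X] : Prop :=
  ∀ o : X, ¬ Bornology.IsBounded (MulAction.orbit H o)

/-- The stable translation length of `g`, computed at the basepoint `o`. -/
noncomputable def stableLength {G X : Type*} [Group G] [MetricSpace X] [MulAction G X]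
    (o : X) (g : G) : ℝ :=
  limUnder atTop (fun n : ℕ => dist o (g ^ n • o) / n)

/-- For an isometric action the limit in the definition of the stable translation length exists. -/
theorem tendsto_stableLength {G X : Type*} [Group G] [MetricSpace X] [MulAction G X]
    [IsIsometricSMul G X] (o : X) (g : G) :
    Tendsto (fun n : ℕ => dist o (g ^ n • o) / n) atTop (𝓝 (stableLength o g)) := by
  have hsub : Subadditive (fun n : ℕ => dist o (g ^ n • o)) := by
    intro m n
    calc dist o (g ^ (m + n) • o)
        ≤ dist o (g ^ m • o) + dist (g ^ m • o) (g ^ (m + n) • o) := dist_triangle _ _ _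
      _ = dist o (g ^ m • o) + dist o (g ^ n • o) := by
          rw [pow_add, mul_smul, dist_smul]
  have hbdd : BddBelow (Set.range fun n : ℕ => dist o (g ^ n • o) / n) :=
    ⟨0, by rintro _ ⟨n, rfl⟩; positivity⟩
  exact tendsto_nhds_limUnder ⟨_, hsub.tendsto_lim hbdd⟩

/-- `G` has marked length spectrum rigidity from the subset `E`, for given actions on `X₁` and
`X₂`: for all basepoints `o₁`, `o₂`, if the two marked length spectra agree on `E`, then
`sup_{g, h ∈ G} |d₁(g o₁, h o₁) - d₂(g o₂, h o₂)| < ∞`; in other words the orbit map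
`g o₁ ↦ g o₂` is well defined up to bounded error and a rough isometry. -/
def HasMLSRigidityFrom (G X₁ X₂ : Type*) [Group G] [MetricSpace X₁] [MetricSpace X₂]
    [MulAction G X₁] [MulAction G X₂] (E : Set G) : Prop :=
  ∀ (o₁ : X₁) (o₂ : X₂), (∀ g ∈ E, stableLength o₁ g = stableLength o₂ g) →
    ∃ C : ℝ, ∀ g h : G, |dist (g • o₁) (h • o₁) - dist (g • o₂) (h • o₂)| ≤ C

end MLS

/-! The core is a two-sided estimate. Let `N` be normalized by `g`, and let `u ∈ N`. Then `w = u *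
(g * u * g⁻¹)` lies in `N`, and its stable length is at most its displacement, hence at most twice
the displacement of `g` plus twice that of `u`. Conversely, `u` can be chosen from a finite set so
that the orbit of `w = u * g * u * g⁻¹` is almost geodesic; then the stable length is at least twice
the displacement of `g` up to an additive constant (`HasExtension.exists_le_stableLength`). So equal
spectra on `N` force the displacements in `X₁` and `X₂` to differ boundedly on every subgroup
normalizing `N`, and therefore to have equal stable lengths there. Applied along the chain, this
carries the equality from `H n` up to `G`.

The finite sets of `u` come from `HasExtension`. It holds for `G` by playing translates of one
contracting axis against another, and it descends to unbounded normal subgroups by replacing `u`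
with a conjugate `u * s * u⁻¹` of a long `s ∈ N`, the barrier being kept
(`HasExtension.of_normalized`). -/

namespace MLS

/-! ### Barriers: abstract strongly contracting projections. -/

section Barrier

variable {X : Type*} [MetricSpace X]

/-- A coarse projection `P` such that two points with distant images are joined almost
geodesically through these images. -/
def IsBarrier (c : ℝ) (P : X → X) : Prop :=
  ∀ x y, c < dist (P x) (P y) → dist x (P x) + dist (P x) (P y) + dist (P y) y ≤ dist x y + c

theorem IsBarrier.mono {c c' : ℝ} {P : X → X} (hP : IsBarrier c P) (h : c ≤ c') :
    IsBarrier c' P := fun x y hxy => by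
  have := hP x y (h.trans_lt hxy)
  linarith

theorem IsBarrier.dist_le {c : ℝ} {P : X → X} (hP : IsBarrier c P) (x y : X) :
    dist (P x) (P y) ≤ dist x y + c := by
  by_cases h : c < dist (P x) (P y)
  · have := hP x y h
    linarith [dist_nonneg (x := x) (y := P x), dist_nonneg (x := P y) (y := y)]
  · linarith [dist_nonneg (x := x) (y := y)]

theorem IsBarrier.translate {G : Type*} [Group G] [MulAction G X] [IsIsometricSMul G X]
    {c : ℝ} {P : X → X} (hP : IsBarrier c P) (k : G) :
    IsBarrier c (fun x => k • P (k⁻¹ • x)) := by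
  intro x y hxy
  have h := hP (k⁻¹ • x) (k⁻¹ • y)
  simp only [dist_smul] at hxy h
  have e1 : dist x (k • P (k⁻¹ • x)) = dist (k⁻¹ • x) (P (k⁻¹ • x)) := by
    rw [← dist_smul k (k⁻¹ • x), smul_inv_smul]
  have e2 : dist (k • P (k⁻¹ • y)) y = dist (P (k⁻¹ • y)) (k⁻¹ • y) := by
    rw [← dist_smul k _ (k⁻¹ • y), smul_inv_smul]
  rw [e1, e2, dist_smul]
  exact h hxy

/-- If `z` lies behind the barrier `Q` as seen from `a`, then the barrier `P` sees `z` in the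
direction of `b`. -/
theorem IsBarrier.dist_le_of_behind {c M : ℝ} {P Q : X → X} (hP : IsBarrier c P)
    (hQ : IsBarrier c Q) {a b z : X} (hz : c < dist (Q a) (Q z)) (hb : dist (Q a) b ≤ M)
    (ha : dist (P b) a ≤ M) (hab : 2 * M + c < dist a b) : dist (P b) (P z) ≤ c := by
  -- Otherwise a geodesic from `a` to `z` passes near `b`, and one from `b` to `z` passes near `a`;
  -- adding the two estimates bounds `dist a b` by `2 * M + c`.
  by_contra! h
  have h1 := hQ a z hz
  have h2 := hP b z h
  have := dist_triangle (Q a) (Q z) z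
  have := dist_triangle (P b) (P z) z
  have := dist_triangle a (Q a) b
  have := dist_triangle b (P b) a
  have := dist_triangle b (Q a) z
  have := dist_triangle a (P b) z
  have := dist_comm b (Q a)
  have := dist_comm a (P b)
  have := dist_comm a b
  linarith

/-- A geodesic issuing from a point `o` of a barrier stays close to the barrier until it reaches
the projection of its endpoint. -/
theorem IsBarrier.dist_apply_le {c : ℝ} {P : X → X} (hP : IsBarrier c P) (hc : 0 ≤ c) {o x y : X}
    (ho : dist o (P o) ≤ 1) (hy : dist o y + dist y x = dist o x)
    (hyx : dist o y ≤ dist o (P x)) : dist y (P y) ≤ 3 * c + 3 := by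
  have t1 := dist_triangle o (P o) (P y)
  have t2 := dist_triangle o (P o) (P x)
  have t3 := dist_triangle (P o) (P y) (P x)
  have t4 := dist_triangle o (P x) x
  have t5 := dist_triangle y o (P y)
  have t6 := dist_comm y o
  have t7 := dist_comm (P y) y
  have n1 := dist_nonneg (x := o) (y := P o)
  have n2 := dist_nonneg (x := o) (y := y)
  have n3 := dist_nonneg (x := P y) (y := P x)
  have n4 := dist_nonneg (x := P x) (y := x)
  by_cases h1 : c < dist (P o) (P y)
  · have h1' := hP o y h1
    by_cases h2 : c < dist (P y) (P x)
    · have h2' := hP y x h2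
      linarith
    · linarith
  · by_cases h2 : c < dist (P y) (P x)
    · have h2' := hP y x h2
      linarith
    · linarith

end Barrier

/-! ### Axes of contracting elements as barriers. -/

section Contracting

variable {X : Type*} [MetricSpace X]

theorem proj_nonempty {Y : Set X} (hY : Y.Nonempty) (x : X) : (proj Y x).Nonempty := by
  obtain ⟨y, hy, h⟩ := (Metric.infDist_lt_iff (r := Metric.infDist x Y + 1) hY).1 (by linarith)
  exact ⟨y, hy, h.le⟩

theorem IsGeodesicSegment.mono {L L' : ℝ} {α : ℝ → X} (hα : IsGeodesicSegment L α)
    (h0 : 0 ≤ L') (h : L' ≤ L) : IsGeodesicSegment L' α :=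
  ⟨h0, fun s hs t ht => hα.2 s ⟨hs.1, hs.2.trans h⟩ t ⟨ht.1, ht.2.trans h⟩⟩

theorem IsGeodesicSegment.reverse {L : ℝ} {α : ℝ → X} (hα : IsGeodesicSegment L α) :
    IsGeodesicSegment L (fun t => α (L - t)) := by
  refine ⟨hα.1, fun s hs t ht => ?_⟩
  rw [hα.2 _ ⟨by linarith [hs.2], by linarith [hs.1]⟩ _ ⟨by linarith [ht.2], by linarith [ht.1]⟩,
    abs_sub_comm]
  congr 1
  ring

theorem IsGeodesicSegment.continuousOn {L : ℝ} {α : ℝ → X} (hα : IsGeodesicSegment L α) :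
    ContinuousOn α (Set.Icc 0 L) := by
  have : LipschitzOnWith 1 α (Set.Icc 0 L) := LipschitzOnWith.of_dist_le_mul fun s hs t ht => by
    rw [hα.2 s hs t ht, NNReal.coe_one, one_mul, Real.dist_eq]
  exact this.continuousOn

/-- A geodesic approaching a contracting set enters its neighbourhood near the projection of its
starting point. -/
theorem IsContractingWith.exists_entrance {C : ℝ} {Y : Set X} (hY : IsContractingWith C Y)
    (hC : 0 ≤ C) {L : ℝ} {α : ℝ → X} (hα : IsGeodesicSegment L α)
    (hne : ∃ t ∈ Set.Icc 0 L, Metric.infDist (α t) Y ≤ C) {p : X} (hp : p ∈ proj Y (α 0)) :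
    ∃ t₁ ∈ Set.Icc 0 L, Metric.infDist (α t₁) Y ≤ C ∧
      (∀ t ∈ Set.Icc 0 L, Metric.infDist (α t) Y ≤ C → t₁ ≤ t) ∧ dist (α t₁) p ≤ 2 * C + 1 := by
  have hcont : ContinuousOn (fun t => Metric.infDist (α t) Y) (Set.Icc 0 L) :=
    (Metric.continuous_infDist_pt Y).comp_continuousOn hα.continuousOn
  set S := Set.Icc 0 L ∩ (fun t => Metric.infDist (α t) Y) ⁻¹' Set.Iic C with hS
  have hclosed : IsClosed S := hcont.preimage_isClosed_of_isClosed isClosed_Icc isClosed_Iic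
  have hSne : S.Nonempty := by
    obtain ⟨t, ht, h⟩ := hne
    exact ⟨t, ht, h⟩
  have hSbdd : BddBelow S := ⟨0, fun t ht => ht.1.1⟩
  have hmem : sInf S ∈ S := hclosed.csInf_mem hSne hSbdd
  have hmin : ∀ t ∈ Set.Icc 0 L, Metric.infDist (α t) Y ≤ C → sInf S ≤ t :=
    fun t ht h => csInf_le hSbdd ⟨ht, h⟩
  refine ⟨sInf S, hmem.1, hmem.2, hmin, ?_⟩
  set t₁ := sInf S
  have ht₁ : Metric.infDist (α t₁) Y ≤ C := hmem.2
  rcases hmem.1.1.eq_or_lt with h0 | h0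
  · rw [← h0] at ht₁ ⊢
    linarith [hp.2]
  · obtain ⟨q, hq⟩ := proj_nonempty ⟨p, hp.1⟩ (α t₁)
    have hfar : ∀ s ∈ Set.Ico 0 t₁, C ≤ Metric.infDist (α s) Y := fun s hs => by
      by_contra! h
      exact absurd (hmin s ⟨hs.1, hs.2.le.trans hmem.1.2⟩ h.le) (not_le.2 hs.2)
    -- Continuity includes the entrance time itself, so contraction applies to the whole closed
    -- initial segment.
    have hfar' : ∀ s ∈ Set.Icc 0 t₁, C ≤ Metric.infDist (α s) Y := by
      intro s hs
      have hcl : s ∈ closure (Set.Ico 0 t₁) := by rwa [closure_Ico h0.ne]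
      have := mem_closure_iff_nhdsWithin_neBot.1 hcl
      refine ge_of_tendsto (x := 𝓝[Set.Ico 0 t₁] s) (f := fun t => Metric.infDist (α t) Y) ?_ ?_
      · exact (hcont s ⟨hs.1, hs.2.trans hmem.1.2⟩).mono_left
          (nhdsWithin_mono _ fun u hu => ⟨hu.1, hu.2.le.trans hmem.1.2⟩)
      · exact eventually_nhdsWithin_of_forall hfar
    have hpq : dist p q ≤ C := by
      refine hY t₁ α (hα.mono h0.le hmem.1.2) ?_ p ?_ q ?_
      · rintro _ ⟨s, hs, rfl⟩ y hy
        exact (hfar' s hs).trans (Metric.infDist_le_dist_of_mem hy)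
      · exact Set.mem_biUnion ⟨0, ⟨le_rfl, h0.le⟩, rfl⟩ hp
      · exact Set.mem_biUnion ⟨t₁, ⟨h0.le, le_rfl⟩, rfl⟩ hq
    linarith [hq.2, dist_triangle (α t₁) q p, dist_comm p q]

/-- Two points with distant projections to a contracting set are joined almost geodesically
through these projections. -/
theorem IsContractingSet.exists_bound (hX : IsGeodesicSpace X) {Y : Set X}
    (hY : IsContractingSet Y) : ∃ c : ℝ, 0 ≤ c ∧ ∀ x y : X, ∀ p ∈ proj Y x, ∀ q ∈ proj Y y,
      c < dist p q → dist x p + dist p q + dist q y ≤ dist x y + c := by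
  obtain ⟨C, hC, hY⟩ := hY
  -- Each of the two entrance points is within `2 * C + 1` of its projection, and each such error is
  -- paid twice.
  refine ⟨8 * C + 4, by linarith, fun x y p hp q hq hpq => ?_⟩
  obtain ⟨L, α, hα, rfl, rfl⟩ := hX x y
  by_cases hne : ∃ t ∈ Set.Icc 0 L, Metric.infDist (α t) Y ≤ C
  · obtain ⟨t₁, ht₁, h₁, -, hd₁⟩ := hY.exists_entrance hC hα hne hp
    obtain ⟨t₂, ht₂, -, hmin, hd₂⟩ := hY.exists_entrance hC hα.reverse (p := q)
      (by
        obtain ⟨t, ht, h⟩ := hne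
        exact ⟨L - t, ⟨by linarith [ht.2], by linarith [ht.1]⟩, by simpa using h⟩)
      (by simpa using hq)
    have hle := hmin (L - t₁) ⟨by linarith [ht₁.2], by linarith [ht₁.1]⟩ (by simpa using h₁)
    have m0 : (0 : ℝ) ∈ Set.Icc 0 L := ⟨le_rfl, hα.1⟩
    have mL : L ∈ Set.Icc 0 L := ⟨hα.1, le_rfl⟩
    have m2 : L - t₂ ∈ Set.Icc 0 L := ⟨by linarith [ht₂.2], by linarith [ht₂.1]⟩
    have e1 := hα.2 0 m0 t₁ ht₁
    have e2 := hα.2 t₁ ht₁ _ m2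
    have e3 := hα.2 _ m2 L mL
    have e4 := hα.2 0 m0 L mL
    rw [abs_of_nonpos (by linarith [ht₁.1])] at e1
    rw [abs_of_nonpos (by linarith)] at e2
    rw [abs_of_nonpos (by linarith [ht₂.1])] at e3
    rw [abs_of_nonpos (by linarith [hα.1])] at e4
    have := dist_triangle (α 0) (α t₁) p
    have := dist_triangle4 p (α t₁) (α (L - t₂)) q
    have := dist_triangle q (α (L - t₂)) (α L)
    have := dist_comm p (α t₁)
    have := dist_comm q (α (L - t₂))
    linarith
  · push Not at hne
    have h : dist p q ≤ C := by
      refine hY L α hα ?_ p ?_ q ?_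
      · rintro _ ⟨s, hs, rfl⟩ y hy
        exact (hne s hs).le.trans (Metric.infDist_le_dist_of_mem hy)
      · exact Set.mem_biUnion ⟨0, ⟨le_rfl, hα.1⟩, rfl⟩ hp
      · exact Set.mem_biUnion ⟨L, ⟨hα.1, le_rfl⟩, rfl⟩ hq
    linarith

variable {G : Type*} [Group G] [MulAction G X]

theorem IsContractingElement.exists_lt_dist {o : X} {g : G} (hg : IsContractingElement o g)
    (D : ℝ) : ∃ m : ℕ, ∀ j : ℤ, m ≤ |j| → D < dist o (g ^ j • o) := by
  obtain ⟨l, c, hl, hc, h⟩ := hg.2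
  obtain ⟨m, hm⟩ := exists_nat_gt (l * (D + c))
  refine ⟨m, fun j hj => ?_⟩
  have h1 := (h 0 j).1
  have h2 : dist (0 : ℤ) j = ((|j| : ℤ) : ℝ) := by simp [Int.dist_eq]
  simp only [zpow_zero, one_smul, h2] at h1
  have h3 : (m : ℝ) ≤ ((|j| : ℤ) : ℝ) := by exact_mod_cast hj
  have h4 : D + c < 1 / l * ((|j| : ℤ) : ℝ) := by
    rw [one_div, ← div_eq_inv_mul, lt_div_iff₀ (by linarith), mul_comm]
    linarith
  linarith

variable [IsIsometricSMul G X]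

theorem zpow_smul_mem_proj {o x p : X} {g : G} (m : ℤ) (hp : p ∈ proj (cyclicOrbit o g) x) :
    g ^ m • p ∈ proj (cyclicOrbit o g) (g ^ m • x) := by
  have hinv : ∀ (m : ℤ) (y : X), y ∈ cyclicOrbit o g → g ^ m • y ∈ cyclicOrbit o g := by
    rintro m _ ⟨⟨k, hk⟩, rfl⟩
    exact ⟨⟨g ^ m, m, rfl⟩ * ⟨k, hk⟩, mul_smul (g ^ m) k o⟩
  refine ⟨hinv m p hp.1, ?_⟩
  rw [dist_smul]
  refine hp.2.trans (add_le_add_left ?_ 1)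
  refine (Metric.le_infDist ⟨p, hp.1⟩).2 fun y hy => ?_
  have := Metric.infDist_le_dist_of_mem (x := x) (hinv (-m) y hy)
  rwa [← dist_smul (g ^ m), zpow_neg, smul_inv_smul] at this

/-- The projection to the axis of a contracting element is an almost equivariant barrier. -/
theorem IsContractingElement.exists_barrier (hX : IsGeodesicSpace X) {o : X} {g : G}
    (hg : IsContractingElement o g) : ∃ (c : ℝ) (P : X → X), 0 ≤ c ∧ IsBarrier c P ∧
      (∀ x, P x ∈ cyclicOrbit o g) ∧ dist o (P o) ≤ 1 ∧
      ∀ (m : ℤ) (x : X), dist (P (g ^ m • x)) (g ^ m • P x) ≤ c := by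
  obtain ⟨c, hc, h⟩ := hg.1.exists_bound hX
  have ho : o ∈ cyclicOrbit o g := MulAction.mem_orbit_self o
  choose P hP using proj_nonempty (Y := cyclicOrbit o g) ⟨o, ho⟩
  refine ⟨c, P, hc, fun x y hxy => h x y _ (hP x) _ (hP y) hxy, fun x => (hP x).1, ?_,
    fun m x => ?_⟩
  · simpa [Metric.infDist_zero_of_mem ho] using (hP o).2
  -- Both points are coarse projections of the same point `g ^ m • x`, so the bound applies with
  -- equal endpoints.
  · by_contra! hlt
    have := h _ _ _ (hP (g ^ m • x)) _ (zpow_smul_mem_proj m (hP x)) hlt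
    rw [dist_self] at this
    linarith [dist_nonneg (x := g ^ m • x) (y := P (g ^ m • x)),
      dist_nonneg (x := g ^ m • P x) (y := g ^ m • x)]

/-- A point cannot project far from `o` on both of two weakly independent axes. -/
theorem HasBoundedIntersection.dist_le_or_dist_le (hX : IsGeodesicSpace X) {R : ℝ≥0 → ℝ≥0}
    {Y Z : Set X} (hR : HasBoundedIntersection R Y Z) {c : ℝ} (hc : 0 ≤ c) {P Q : X → X}
    (hP : IsBarrier c P) (hQ : IsBarrier c Q) (hPY : ∀ x, P x ∈ Y) (hQZ : ∀ x, Q x ∈ Z) {o : X}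
    (hPo : dist o (P o) ≤ 1) (hQo : dist o (Q o) ≤ 1) :
    ∃ T : ℝ, ∀ x, dist o (P x) ≤ T ∨ dist o (Q x) ≤ T := by
  set r : ℝ≥0 := ⟨3 * c + 3, by linarith⟩ with hr
  have hrc : (r : ℝ) = 3 * c + 3 := rfl
  refine ⟨R r + 1 + c, fun x => ?_⟩
  by_contra! hx
  obtain ⟨L, α, hα, h0, hL⟩ := hX o x
  have hD : dist o x = L := by
    rw [← h0, ← hL, hα.2 0 ⟨le_rfl, hα.1⟩ L ⟨hα.1, le_rfl⟩, zero_sub, abs_neg, abs_of_nonneg hα.1]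
  have hRL : (R r : ℝ) < L := by
    linarith [hP.dist_le o x, dist_triangle o (P o) (P x), hx.1]
  have hR0 : (0 : ℝ) ≤ R r := (R r).2
  -- Up to time `t` the geodesic has passed neither projection, so `α t` is near both axes although
  -- `t` exceeds the diameter bound `R r`.
  set t := min (min (dist o (P x)) (dist o (Q x))) L with ht
  have htR : (R r : ℝ) < t := lt_min (lt_min (by linarith) (by linarith)) hRL
  have htL : t ≤ L := min_le_right _ _
  have htm : t ∈ Set.Icc 0 L := ⟨by linarith, htL⟩
  have d1 : dist o (α t) = t := by
    rw [← h0, hα.2 0 ⟨le_rfl, hα.1⟩ t htm, zero_sub, abs_neg, abs_of_nonneg htm.1]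
  have d2 : dist (α t) x = L - t := by
    rw [← hL, hα.2 t htm L ⟨hα.1, le_rfl⟩, abs_sub_comm, abs_of_nonneg (by linarith)]
  have hb : dist o (α t) + dist (α t) x = dist o x := by linarith
  have hy1 := hP.dist_apply_le hc hPo hb
    (d1.le.trans ((min_le_left _ _).trans (min_le_left _ _)))
  have hy2 := hQ.dist_apply_le hc hQo hb
    (d1.le.trans ((min_le_left _ _).trans (min_le_right _ _)))
  have := hR r o
    ⟨Metric.mem_cthickening_of_dist_le _ _ _ _ (hPY o) (by linarith),
      Metric.mem_cthickening_of_dist_le _ _ _ _ (hQZ o) (by linarith)⟩ (α t)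
    ⟨Metric.mem_cthickening_of_dist_le _ _ _ _ (hPY (α t)) (by linarith),
      Metric.mem_cthickening_of_dist_le _ _ _ _ (hQZ (α t)) (by linarith)⟩
  linarith

end Contracting

/-! ### The extension property and its descent to normal subgroups. -/

section Extension

variable {G X : Type*} [Group G] [MetricSpace X] [MulAction G X]

/-- The extension property: for any `k` elements `s` of `G`, one of finitely many elements `u` of
`K` comes with a barrier that separates, in a controlled way, all the points `s • o` from all the
points `u • s • o`. -/
def HasExtension (K : Subgroup G) (o : X) : Prop :=
  ∀ k : ℕ, ∃ c τ : ℝ, 0 ≤ c ∧ ∀ L : ℝ, ∃ (M : ℝ) (E : Set (G × (X → X))), E.Finite ∧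
    (∀ e ∈ E, e.1 ∈ K ∧ IsBarrier c e.2 ∧ dist o (e.1 • o) ≤ M) ∧
    ∀ S : Finset G, S.card ≤ k → ∃ e ∈ E, ∀ s ∈ S, dist o (e.2 (s • o)) ≤ τ ∧
      L ≤ dist o (e.2 (e.1 • s • o)) ∧ dist o (e.2 (e.1 • s • o)) ≤ M

theorem IsUnboundedIn.exists_lt_dist {N : Subgroup G} (hN : IsUnboundedIn N X) (o : X) (D : ℝ) :
    ∃ s ∈ N, D < dist o (s • o) := by
  by_contra! h
  refine hN o ((Metric.isBounded_iff_subset_closedBall o).2 ⟨D, ?_⟩)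
  rintro _ ⟨⟨s, hs⟩, rfl⟩
  rw [Metric.mem_closedBall, dist_comm]
  exact h s hs

theorem IsUnboundedIn.mono {N K : Subgroup G} (hN : IsUnboundedIn N X) (h : N ≤ K) :
    IsUnboundedIn K X := by
  intro o hb
  refine hN o (hb.subset ?_)
  rintro _ ⟨⟨s, hs⟩, rfl⟩
  exact ⟨⟨s, h hs⟩, rfl⟩

variable [IsIsometricSMul G X]

theorem HasExtension.of_basepoint {K : Subgroup G} {o : X} (h : HasExtension K o) (o' : X) :
    HasExtension K o' := by
  intro k
  obtain ⟨c, τ, hc, h⟩ := h k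
  have key : ∀ P : X → X, IsBarrier c P → ∀ g : G,
      |dist o' (P (g • o')) - dist o (P (g • o))| ≤ 2 * dist o o' + c := by
    intro P hP g
    have h1 := hP.dist_le (g • o) (g • o')
    rw [dist_smul] at h1
    have h2 := dist_triangle4 o' o (P (g • o)) (P (g • o'))
    have h3 := dist_triangle4 o o' (P (g • o')) (P (g • o))
    have h4 := dist_comm o o'
    have h5 := dist_comm (P (g • o)) (P (g • o'))
    rw [abs_le]
    constructor <;> linarith
  refine ⟨c, τ + (2 * dist o o' + c), hc, fun L => ?_⟩
  obtain ⟨M, E, hfin, hE, hS⟩ := h (L + (2 * dist o o' + c))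
  refine ⟨M + (2 * dist o o' + c), E, hfin, fun e he => ⟨(hE e he).1, (hE e he).2.1, ?_⟩,
    fun S hcard => ?_⟩
  · have h1 := dist_triangle4 o' o (e.1 • o) (e.1 • o')
    rw [dist_smul] at h1
    linarith [(hE e he).2.2, dist_comm o o']
  · obtain ⟨e, he, hs⟩ := hS S hcard
    refine ⟨e, he, fun s hsS => ?_⟩
    obtain ⟨h1, h2, h3⟩ := hs s hsS
    have k1 := abs_le.1 (key e.2 (hE e he).2.1 s)
    have k2 := abs_le.1 (key e.2 (hE e he).2.1 (e.1 * s))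
    rw [mul_smul, mul_smul] at k2
    exact ⟨by linarith, by linarith, by linarith⟩

/-- The barriers are `k + 1` translates of the axis of `h` by widely spaced powers of `g`. A point
projecting far on the `i`-th translate projects near `t i • o` on the axis of `g`, so it is bad for
at most one `i`; by pigeonhole some translate is good for all `k` points. A large power of the
conjugate of `h` along that translate then pushes them far. -/
theorem HasContractingProperty.hasExtension_top (hX : IsGeodesicSpace X)
    (hG : HasContractingProperty G X) (o' : X) : HasExtension (⊤ : Subgroup G) o' := by
  obtain ⟨o, g, h, hg, hh, R, hR⟩ := hG
  refine HasExtension.of_basepoint (o := o) (fun k => ?_) o'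
  obtain ⟨cg, Q, hcg, hQ, hQA, hQo, hQe⟩ := hg.exists_barrier hX
  obtain ⟨ch, P, hch, hP, hPA, hPo, hPe⟩ := hh.exists_barrier hX
  set c := max cg ch
  have hc : 0 ≤ c := hcg.trans (le_max_left _ _)
  replace hQ := hQ.mono (le_max_left cg ch)
  replace hP := hP.mono (le_max_right cg ch)
  replace hQe := fun m x => (hQe m x).trans (le_max_left cg ch)
  replace hPe := fun m x => (hPe m x).trans (le_max_right cg ch)
  obtain ⟨T, hT⟩ := hR.dist_le_or_dist_le hX hc hQ hP hQA hPA hQo hPo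
  obtain ⟨m, hm⟩ := hg.exists_lt_dist (2 * (T + c))
  let t : Fin (k + 1) → G := fun i => g ^ ((m * (i : ℕ) : ℕ) : ℤ)
  obtain ⟨B, hB⟩ : ∃ B, ∀ i, dist o (t i • o) ≤ B :=
    let ⟨B, hB⟩ := (Set.finite_range fun i => dist o (t i • o)).bddAbove
    ⟨B, fun i => hB ⟨i, rfl⟩⟩
  have hfar : ∀ i x, T + B < dist o (t i • P ((t i)⁻¹ • x)) →
      dist (t i • o) (Q x) ≤ T + c := by
    intro i x hx
    have h1 : T < dist o (P ((t i)⁻¹ • x)) := by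
      have := dist_triangle o (t i • o) (t i • P ((t i)⁻¹ • x))
      rw [dist_smul] at this
      linarith [hB i]
    have h2 := (hT ((t i)⁻¹ • x)).resolve_right (not_le.2 h1)
    have h3 := hQe ((m * (i : ℕ) : ℕ) : ℤ) ((t i)⁻¹ • x)
    change dist (Q (t i • (t i)⁻¹ • x)) (t i • Q ((t i)⁻¹ • x)) ≤ c at h3
    rw [smul_inv_smul, dist_comm] at h3
    have h4 := dist_triangle (t i • o) (t i • Q ((t i)⁻¹ • x)) (Q x)
    rw [dist_smul] at h4
    linarith
  have huniq : ∀ x i j, T + B < dist o (t i • P ((t i)⁻¹ • x)) →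
      T + B < dist o (t j • P ((t j)⁻¹ • x)) → i = j := by
    intro x i j hi hj
    by_contra hij
    have h1 := hm (((m * (j : ℕ) : ℕ) : ℤ) - ((m * (i : ℕ) : ℕ) : ℤ)) (by
      have h2 : (1 : ℤ) ≤ |(j : ℤ) - (i : ℤ)| := by
        refine Int.one_le_abs (sub_ne_zero.2 fun h => hij ?_)
        exact (Fin.ext (by exact_mod_cast h)).symm
      push_cast
      rw [← mul_sub, abs_mul, Nat.abs_cast]
      nlinarith [Int.natCast_nonneg m])
    rw [sub_eq_neg_add, zpow_add, zpow_neg, ← dist_smul (t i), smul_smul] at h1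
    change _ < dist (t i • o) ((t i * ((t i)⁻¹ * t j)) • o) at h1
    rw [mul_inv_cancel_left] at h1
    have := dist_triangle_right (t i • o) (t j • o) (Q x)
    linarith [hfar i x hi, hfar j x hj]
  -- The translates do not depend on `L`; only the power `r` does. Hence `c` and `τ` can be fixed
  -- before `L`.
  refine ⟨c, T + B, hc, fun L => ?_⟩
  obtain ⟨r, hr⟩ := hh.exists_lt_dist (L + (T + B) + c + 2 * B)
  let u : Fin (k + 1) → G := fun i => t i * h ^ (r : ℤ) * (t i)⁻¹
  obtain ⟨M, hM⟩ : ∃ M, ∀ i, dist o (u i • o) ≤ M :=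
    let ⟨M, hM⟩ := (Set.finite_range fun i => dist o (u i • o)).bddAbove
    ⟨M, fun i => hM ⟨i, rfl⟩⟩
  refine ⟨M + |T + B| + c, Set.range fun i => (u i, fun x => t i • P ((t i)⁻¹ • x)),
    Set.finite_range _, ?_, fun S hS => ?_⟩
  · rintro _ ⟨i, rfl⟩
    exact ⟨Subgroup.mem_top _, hP.translate (t i), by linarith [hM i, abs_nonneg (T + B)]⟩
  · obtain ⟨i, hi⟩ : ∃ i, ∀ s ∈ S, dist o (t i • P ((t i)⁻¹ • s • o)) ≤ T + B := by
      by_contra! hbad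
      choose s hs hbad using hbad
      obtain ⟨i, -, j, -, hij, he⟩ := Finset.exists_ne_map_eq_of_card_lt_of_maps_to
        (s := Finset.univ) (t := S) (f := s) (by simpa using Nat.lt_succ_of_le hS)
        (fun i _ => hs i)
      exact hij (huniq (s i • o) i j (hbad i) (he ▸ hbad j))
    refine ⟨_, ⟨i, rfl⟩, fun s hs => ?_⟩
    have h1 := hi s hs
    have h2 : dist (t i • P ((t i)⁻¹ • u i • s • o)) (u i • t i • P ((t i)⁻¹ • s • o)) ≤ c := by
      have := hPe r ((t i)⁻¹ • s • o)
      rw [← dist_smul (t i)] at this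
      simpa only [u, mul_smul, inv_smul_smul] using this
    have h3 : dist (u i • t i • P ((t i)⁻¹ • s • o)) (u i • o) ≤ T + B := by
      rwa [dist_smul, dist_comm]
    have h4 : L + (T + B) + c < dist o (u i • o) := by
      have h5 := hr r (by simp)
      have h6 := dist_triangle4 (t i • o) o (u i • o) (u i • t i • o)
      have h7 : dist (t i • o) (u i • t i • o) = dist o (h ^ (r : ℤ) • o) := by
        rw [← dist_smul (t i) o]
        simp only [u, mul_smul, inv_smul_smul]
      rw [h7, dist_smul, dist_comm (t i • o) o] at h6
      linarith [hB i]
    have h8 := dist_triangle4 o (u i • o) (u i • t i • P ((t i)⁻¹ • s • o))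
      (t i • P ((t i)⁻¹ • u i • s • o))
    have h9 := dist_triangle4 o (t i • P ((t i)⁻¹ • u i • s • o))
      (u i • t i • P ((t i)⁻¹ • s • o)) (u i • o)
    rw [dist_comm (u i • o),
      dist_comm (u i • t i • P ((t i)⁻¹ • s • o)) (t i • P ((t i)⁻¹ • u i • s • o))] at h8
    refine ⟨h1, ?_, ?_⟩ <;> dsimp only <;> linarith [hM i, le_abs_self (T + B)]

/-- The extension property passes to unbounded normal subgroups. -/
theorem HasExtension.of_normalized {K N : Subgroup G} {o : X} (hK : HasExtension K o)
    (hKN : ∀ g ∈ K, ∀ s ∈ N, g * s * g⁻¹ ∈ N) (hN : IsUnboundedIn N X) : HasExtension N o := by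
  classical
  intro k
  -- The two extra places are for `s` and `s⁻¹`.
  obtain ⟨c, τ, hc, h⟩ := hK (k + 2)
  refine ⟨c, τ, hc, fun L => ?_⟩
  -- `L + c` absorbs the error `c` in `key`; `τ + c + 1` puts the images of `j • o` and `u • s⁻¹ •
  -- o` more than `c` apart.
  obtain ⟨M, E, hfin, hE, hS⟩ := h (max (L + c) (τ + c + 1))
  obtain ⟨s, hsN, hs⟩ := hN.exists_lt_dist o (2 * (2 * M) + c)
  refine ⟨2 * M + dist o (s • o) + c, (fun e => (e.1 * s * e.1⁻¹, e.2)) '' E, hfin.image _, ?_,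
    fun S hcard => ?_⟩
  · rintro _ ⟨e, he, rfl⟩
    obtain ⟨h1, h2, h3⟩ := hE e he
    refine ⟨hKN _ h1 _ hsN, h2, ?_⟩
    have h4 := dist_triangle4 o (e.1 • o) (e.1 • s • o) ((e.1 * s * e.1⁻¹) • o)
    have h5 : dist (e.1 • s • o) ((e.1 * s * e.1⁻¹) • o) = dist o (e.1 • o) := by
      rw [mul_smul, mul_smul, dist_smul, dist_smul, ← dist_smul e.1, smul_inv_smul, dist_comm]
    rw [dist_smul, h5] at h4
    linarith
  · obtain ⟨e, he, hgood⟩ := hS (insert s (insert s⁻¹ S))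
      ((Finset.card_insert_le _ _).trans
        (Nat.succ_le_succ ((Finset.card_insert_le _ _).trans (Nat.succ_le_succ hcard))))
    obtain ⟨-, hP, hu⟩ := hE e he
    obtain ⟨u, P⟩ := e
    simp only at hP hu hgood
    obtain ⟨-, hs1, hs2⟩ := hgood s (by simp)
    obtain ⟨-, hi1, hi2⟩ := hgood s⁻¹ (by simp)
    refine ⟨_, ⟨_, he, rfl⟩, fun j hj => ?_⟩
    obtain ⟨hj1, -, -⟩ := hgood j (by simp [hj])
    have hi1' := (le_max_right (L + c) (τ + c + 1)).trans hi1
    have hs1' := (le_max_left (L + c) (τ + c + 1)).trans hs1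
    -- The second barrier is the translate of `P` by `u * s * u⁻¹`: it lies near `u • s • o` and
    -- separates `u • o` from the moved point, while `P` itself passes near `u • o`.
    have key : dist (P (u • s • o)) (P ((u * s * u⁻¹) • j • o)) ≤ c := by
      have e1 : (u * s * u⁻¹)⁻¹ • u • o = u • s⁻¹ • o := by
        simp only [smul_smul]
        congr 1
        group
      refine hP.dist_le_of_behind (hP.translate (u * s * u⁻¹)) (a := u • o) (M := 2 * M)
        ?_ ?_ ?_ ?_
      · rw [dist_smul, inv_smul_smul, e1]
        have := dist_triangle o (P (j • o)) (P (u • s⁻¹ • o))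
        have := dist_comm (P (j • o)) (P (u • s⁻¹ • o))
        linarith
      · have e2 : u • s • o = (u * s * u⁻¹) • u • o := by simp [mul_smul]
        rw [e1, e2, dist_smul]
        linarith [dist_triangle_left (P (u • s⁻¹ • o)) (u • o) o]
      · linarith [dist_triangle_left (P (u • s • o)) (u • o) o]
      · rwa [dist_smul]
    have h1 := dist_triangle o (P ((u * s * u⁻¹) • j • o)) (P (u • s • o))
    have h2 := dist_triangle o (P (u • s • o)) (P ((u * s * u⁻¹) • j • o))
    have h3 := dist_comm (P (u • s • o)) (P ((u * s * u⁻¹) • j • o))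
    have h4 := dist_nonneg (x := o) (y := u • o)
    have h5 := dist_nonneg (x := o) (y := s • o)
    exact ⟨hj1, by linarith, by linarith⟩

end Extension

/-! ### Stable lengths from below. -/

section StableLength

variable {G X : Type*} [Group G] [MetricSpace X] [MulAction G X] [IsIsometricSMul G X]

theorem le_stableLength {o : X} {w : G} {a b : ℝ} (h : ∀ n : ℕ, n * a - b ≤ dist o (w ^ n • o)) :
    a ≤ stableLength o w := by
  have hlim : Tendsto (fun n : ℕ => a - b / n) atTop (𝓝 (a - 0)) :=
    tendsto_const_nhds.sub (tendsto_const_div_atTop_nhds_zero_nat b)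
  rw [sub_zero] at hlim
  refine le_of_tendsto_of_tendsto hlim (tendsto_stableLength o w) ?_
  filter_upwards [eventually_gt_atTop 0] with n hn
  have hn' : (0 : ℝ) < n := Nat.cast_pos.2 hn
  rw [le_div_iff₀ hn', sub_mul, div_mul_cancel₀ _ hn'.ne', mul_comm]
  exact h n

theorem dist_pow_smul_le (o : X) (w : G) (n : ℕ) : dist o (w ^ n • o) ≤ n * dist o (w • o) := by
  induction n with
  | zero => simp
  | succ n ih =>
    have := dist_triangle o (w ^ n • o) (w ^ (n + 1) • o)
    rw [pow_succ, mul_smul, dist_smul] at this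
    rw [pow_succ, mul_smul]
    push_cast
    linarith

theorem stableLength_le (o : X) (w : G) : stableLength o w ≤ dist o (w • o) := by
  refine le_of_tendsto (tendsto_stableLength o w) ?_
  filter_upwards [eventually_gt_atTop 0] with n hn
  rw [div_le_iff₀ (Nat.cast_pos.2 hn), mul_comm]
  exact dist_pow_smul_le o w n

theorem stableLength_nonneg (o : X) (w : G) : 0 ≤ stableLength o w :=
  ge_of_tendsto' (tendsto_stableLength o w) fun n => by positivity

theorem stableLength_eq_of_abs_sub_le {X' : Type*} [MetricSpace X'] [MulAction G X']
    [IsIsometricSMul G X'] {o : X} {o' : X'} {w : G} {C : ℝ}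
    (h : ∀ n : ℕ, |dist o (w ^ n • o) - dist o' (w ^ n • o')| ≤ C) :
    stableLength o w = stableLength o' w := by
  have h1 := (tendsto_stableLength o w).sub (tendsto_stableLength o' w)
  refine sub_eq_zero.1 (tendsto_nhds_unique h1 ?_)
  refine squeeze_zero_norm (fun n => ?_) (tendsto_const_div_atTop_nhds_zero_nat C)
  rw [Real.norm_eq_abs, ← sub_div, abs_div, Nat.abs_cast]
  gcongr
  exact h n

/-- Prefixing a point behind the barrier by a long element `h` and then `u`, the result is again
behind the barrier, and almost no length is lost. -/
theorem IsBarrier.extend {c τ L M : ℝ} {o : X} {P : X → X} (hP : IsBarrier c P) {u h : G}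
    (hu : dist o (u • o) ≤ M) (h1 : dist o (P (h⁻¹ • o)) ≤ τ)
    (h2 : L ≤ dist o (P (u • h • o))) (h3 : dist o (P (u • h • o)) ≤ M)
    (hL : 2 * c + τ < L) (hh : 2 * (2 * M + τ) + c < dist o (h • o)) {z : X}
    (hz1 : L - c ≤ dist o (P z)) (hz2 : dist o (P z) ≤ M + c) :
    (L - c ≤ dist o (P (u • h • z)) ∧ dist o (P (u • h • z)) ≤ M + c) ∧
      dist o (h • o) + dist o z - (2 * M + τ + 2 * c) ≤ dist o (u • h • z) := by
  have n1 : 0 ≤ M := dist_nonneg.trans hu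
  have n2 : 0 ≤ τ := dist_nonneg.trans h1
  have hsep : c < dist (P (h⁻¹ • o)) (P z) := by
    linarith [dist_triangle o (P (h⁻¹ • o)) (P z)]
  constructor
  · have key : dist (P (u • h • o)) (P (u • h • z)) ≤ c := by
      -- The translate by `u * h` passes near `u • h • o` and separates `u • o` from `u • h • z`.
      refine hP.dist_le_of_behind (hP.translate (u * h)) (a := u • o) (M := 2 * M + τ) ?_ ?_ ?_ ?_
      · simpa [mul_smul, dist_smul] using hsep
      · simp only [mul_inv_rev, mul_smul, inv_smul_smul, dist_smul]
        rw [dist_comm]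
        linarith
      · linarith [dist_triangle_left (P (u • h • o)) (u • o) o]
      · rwa [dist_smul]
    have t1 := dist_triangle o (P (u • h • o)) (P (u • h • z))
    have t2 := dist_triangle_right o (P (u • h • o)) (P (u • h • z))
    constructor <;> linarith
  · have b := hP _ _ hsep
    have t1 := dist_triangle (P (h⁻¹ • o)) (P z) z
    have t2 := dist_triangle (h⁻¹ • o) (P (h⁻¹ • o)) o
    have t3 := dist_triangle o (P z) z
    have t4 := dist_triangle (u • o) o (u • h • z)
    have e1 : dist (h⁻¹ • o) o = dist o (h • o) := by
      rw [← dist_smul h, smul_inv_smul]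
    have e2 : dist (h⁻¹ • o) z = dist o (h • z) := by
      rw [← dist_smul h, smul_inv_smul]
    rw [dist_smul] at t4
    have c1 := dist_comm (u • o) o
    have c2 := dist_comm (P (h⁻¹ • o)) o
    have n3 := dist_nonneg (x := P (h⁻¹ • o)) (y := P z)
    linarith

/-- Every element `g` is turned, by one of finitely many elements `u`, into an element
`u g u g⁻¹` whose stable length is at least twice the displacement of `g` up to a bounded error. -/
theorem HasExtension.exists_le_stableLength {N : Subgroup G} {o : X} (hN : HasExtension N o) :
    ∃ (C : ℝ) (E : Set G), E.Finite ∧ (∀ u ∈ E, u ∈ N) ∧ ∀ g : G, ∃ u ∈ E,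
      2 * dist o (g • o) - C ≤ stableLength o (u * g * (u * g⁻¹)) := by
  classical
  obtain ⟨c, τ, hc, h⟩ := hN 2
  obtain ⟨M, E, hfin, hE, hS⟩ := h (2 * c + |τ| + 1)
  set D := 2 * (2 * M + |τ|) + c with hD
  refine ⟨2 * D + 4 * c + |M|, Prod.fst '' E, hfin.image _, ?_, fun g => ?_⟩
  · rintro _ ⟨e, he, rfl⟩
    exact (hE e he).1
  obtain ⟨⟨u, P⟩, he, hgood⟩ := hS {g, g⁻¹} Finset.card_le_two
  refine ⟨u, ⟨_, he, rfl⟩, ?_⟩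
  obtain ⟨-, hP, hu⟩ := hE _ he
  obtain ⟨a1, a2, a3⟩ := hgood g (by simp)
  obtain ⟨b1, b2, b3⟩ := hgood g⁻¹ (by simp)
  simp only at hP hu a1 a2 a3 b1 b2 b3
  have hM : 0 ≤ M := dist_nonneg.trans hu
  have hτ := le_abs_self τ
  have hτ' := abs_nonneg τ
  have hMM := le_abs_self M
  -- For short `g` the claimed lower bound is nonpositive.
  rcases le_or_gt (dist o (g • o)) D with hg | hg
  · have := stableLength_nonneg o (u * g * (u * g⁻¹))
    linarith
  have hg' : dist o (g⁻¹ • o) = dist o (g • o) := by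
    rw [← dist_smul g, smul_inv_smul, dist_comm]
  have step1 := fun z => hP.extend (L := 2 * c + |τ| + 1) (h := g) (τ := |τ|) (z := z) hu
    (b1.trans hτ) a2 a3 (by linarith) hg
  have step2 := fun z => hP.extend (L := 2 * c + |τ| + 1) (h := g⁻¹) (τ := |τ|) (z := z) hu
    (by rw [inv_inv]; exact a1.trans hτ) b2 b3 (by linarith) (by rwa [hg'])
  set w := u * g * (u * g⁻¹) with hw
  have hsmul : ∀ z : X, w • z = u • g • u • g⁻¹ • z := fun z => by simp only [hw, mul_smul]
  -- The induction starts at exponent one: `o` itself need not be behind the barrier, whereas `w •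
  -- o` is.
  have main : ∀ n : ℕ, (2 * c + |τ| + 1 - c ≤ dist o (P (w ^ (n + 1) • o)) ∧
      dist o (P (w ^ (n + 1) • o)) ≤ M + c) ∧
      n * (2 * dist o (g • o) - (2 * D + 4 * c + |M|)) ≤ dist o (w ^ (n + 1) • o) := by
    intro n
    induction n with
    | zero =>
      rw [zero_add, pow_one, hsmul]
      refine ⟨(step1 _ (by linarith) (by linarith)).1, ?_⟩
      simp
    | succ n ih =>
      rw [pow_succ' w (n + 1), mul_smul, hsmul]
      have s2 := step2 _ ih.1.1 ih.1.2
      have s1 := step1 _ s2.1.1 s2.1.2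
      refine ⟨s1.1, ?_⟩
      push_cast
      linarith [s1.2, s2.2, ih.2]
  refine le_stableLength (b := max 0 (2 * dist o (g • o) - (2 * D + 4 * c + |M|))) fun n => ?_
  cases n with
  | zero => simp
  | succ n =>
    push_cast
    linarith [(main n).2, le_max_right 0 (2 * dist o (g • o) - (2 * D + 4 * c + |M|))]

end StableLength

/-! ### Comparison of the two actions. -/

section Rigidity

variable {G X₁ X₂ : Type*} [Group G] [MetricSpace X₁] [MetricSpace X₂]
  [MulAction G X₁] [MulAction G X₂] [IsIsometricSMul G X₁] [IsIsometricSMul G X₂]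

theorem HasExtension.exists_dist_le {N K : Subgroup G} {o₁ : X₁} {o₂ : X₂}
    (hN : HasExtension N o₁) (hKN : ∀ g ∈ K, ∀ s ∈ N, g * s * g⁻¹ ∈ N)
    (hl : ∀ g ∈ N, stableLength o₁ g = stableLength o₂ g) :
    ∃ C : ℝ, ∀ g ∈ K, dist o₁ (g • o₁) ≤ dist o₂ (g • o₂) + C := by
  obtain ⟨C, E, hfin, hEN, hE⟩ := hN.exists_le_stableLength
  obtain ⟨B, hB⟩ := (hfin.image fun u => dist o₂ (u • o₂)).bddAbove
  refine ⟨C / 2 + B, fun g hg => ?_⟩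
  obtain ⟨u, hu, h⟩ := hE g
  have hmem : u * g * (u * g⁻¹) ∈ N := by
    have := N.mul_mem (hEN u hu) (hKN g hg u (hEN u hu))
    rwa [← mul_assoc, ← mul_assoc, mul_assoc (u * g)] at this
  rw [hl _ hmem] at h
  have h1 := stableLength_le o₂ (u * g * (u * g⁻¹))
  have huB : dist o₂ (u • o₂) ≤ B := hB ⟨u, hu, rfl⟩
  have hmul : ∀ a b : G, dist o₂ ((a * b) • o₂) ≤ dist o₂ (a • o₂) + dist o₂ (b • o₂) :=
    fun a b => by
      have := dist_triangle o₂ (a • o₂) ((a * b) • o₂)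
      rwa [mul_smul, dist_smul, ← mul_smul] at this
  have hinv : dist o₂ (g⁻¹ • o₂) = dist o₂ (g • o₂) := by
    rw [← dist_smul g, smul_inv_smul, dist_comm]
  linarith [hmul (u * g) (u * g⁻¹), hmul u g, hmul u g⁻¹]

theorem exists_abs_sub_dist_le {N K : Subgroup G} {o₁ : X₁} {o₂ : X₂}
    (hN₁ : HasExtension N o₁) (hN₂ : HasExtension N o₂)
    (hKN : ∀ g ∈ K, ∀ s ∈ N, g * s * g⁻¹ ∈ N)
    (hl : ∀ g ∈ N, stableLength o₁ g = stableLength o₂ g) :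
    ∃ C : ℝ, ∀ g ∈ K, |dist o₁ (g • o₁) - dist o₂ (g • o₂)| ≤ C := by
  obtain ⟨C₁, h₁⟩ := hN₁.exists_dist_le hKN hl
  obtain ⟨C₂, h₂⟩ := hN₂.exists_dist_le hKN fun g hg => (hl g hg).symm
  refine ⟨max C₁ C₂, fun g hg => abs_le.2 ⟨?_, ?_⟩⟩
  · linarith [h₂ g hg, le_max_right C₁ C₂]
  · linarith [h₁ g hg, le_max_left C₁ C₂]

/-- Since `N` normalizes itself, displacements in `X₁` are bounded by those in `X₂` up to a
constant, so unboundedness transfers. -/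
theorem IsUnboundedIn.of_stableLength_eq {N : Subgroup G} {o₁ : X₁} {o₂ : X₂}
    (hN : HasExtension N o₁) (hunb : IsUnboundedIn N X₁)
    (hl : ∀ g ∈ N, stableLength o₁ g = stableLength o₂ g) : IsUnboundedIn N X₂ := by
  obtain ⟨C, h⟩ := hN.exists_dist_le (K := N)
    (fun g hg s hs => N.mul_mem (N.mul_mem hg hs) (N.inv_mem hg)) hl
  intro o hb
  obtain ⟨D, hD⟩ := (Metric.isBounded_iff_subset_closedBall o₂).1 hb
  obtain ⟨s, hs, hlt⟩ := hunb.exists_lt_dist o₁ (D + 2 * dist o₂ o + C)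
  have h1 : dist (s • o) o₂ ≤ D := hD ⟨⟨s, hs⟩, rfl⟩
  have h2 := dist_triangle_left o₂ (s • o₂) (s • o)
  rw [dist_smul] at h2
  linarith [h s hs, dist_comm o o₂, dist_nonneg (x := o₂) (y := o)]

/-- Every `H i` contains `H n`, so unboundedness of the last subgroup feeds each descent step. -/
theorem hasExtension_of_subnormal {X : Type*} [MetricSpace X] [MulAction G X]
    [IsIsometricSMul G X] (hX : IsGeodesicSpace X) (hG : HasContractingProperty G X) (o : X)
    {n : ℕ} {H : ℕ → Subgroup G} (hH0 : H 0 = ⊤) (hle : ∀ i < n, H (i + 1) ≤ H i)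
    (hconj : ∀ i < n, ∀ g ∈ H i, ∀ s ∈ H (i + 1), g * s * g⁻¹ ∈ H (i + 1))
    (hunb : IsUnboundedIn (H n) X) : ∀ i ≤ n, HasExtension (H i) o := by
  have hanti : ∀ j ≤ n, H n ≤ H j := fun j hj =>
    Nat.decreasingInduction' (P := fun j => H n ≤ H j)
      (fun k hk _ ih => ih.trans (hle k hk)) hj le_rfl
  intro i
  induction i with
  | zero => exact fun _ => hH0 ▸ hG.hasExtension_top hX o
  | succ i ih =>
    exact fun hi => (ih (by omega)).of_normalized (hconj i hi) (hunb.mono (hanti _ hi))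

end Rigidity

end MLS

theorem corollary1p6 {G X₁ X₂ : Type*} [Group G] [MetricSpace X₁] [MetricSpace X₂]
    [MulAction G X₁] [MulAction G X₂] [IsIsometricSMul G X₁] [IsIsometricSMul G X₂]
    (hX₁ : MLS.IsGeodesicSpace X₁) (hX₂ : MLS.IsGeodesicSpace X₂)
    (hG₁ : MLS.HasContractingProperty G X₁) (hG₂ : MLS.HasContractingProperty G X₂)
    (n : ℕ) (H : ℕ → Subgroup G) (hH0 : H 0 = ⊤)
    (hH : ∀ i < n, H (i + 1) ≤ H i ∧ ((H (i + 1)).subgroupOf (H i)).Normal)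
    (hunb : ∀ i ≤ n, MLS.IsUnboundedIn (H i) X₁ ∨ MLS.IsUnboundedIn (H i) X₂) :
    MLS.HasMLSRigidityFrom G X₁ X₂ (H n : Set G) := by
  intro o₁ o₂ hl
  have hle : ∀ i < n, H (i + 1) ≤ H i := fun i hi => (hH i hi).1
  have hconj : ∀ i < n, ∀ g ∈ H i, ∀ s ∈ H (i + 1), g * s * g⁻¹ ∈ H (i + 1) :=
    fun i hi g hg s hs =>
      (hH i hi).2.conj_mem ⟨s, hle i hi hs⟩ (Subgroup.mem_subgroupOf.2 hs) ⟨g, hg⟩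
  have hext₁ := MLS.hasExtension_of_subnormal hX₁ hG₁ o₁ hH0 hle hconj
  have hext₂ := MLS.hasExtension_of_subnormal hX₂ hG₂ o₂ hH0 hle hconj
  have hboth : MLS.IsUnboundedIn (H n) X₁ ∧ MLS.IsUnboundedIn (H n) X₂ := by
    rcases hunb n le_rfl with h | h
    · exact ⟨h, .of_stableLength_eq (hext₁ h n le_rfl) h hl⟩
    · exact ⟨.of_stableLength_eq (hext₂ h n le_rfl) h fun g hg => (hl g hg).symm, h⟩
  replace hext₁ := hext₁ hboth.1
  replace hext₂ := hext₂ hboth.2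
  -- Going up the chain, bounded difference of displacements on `H i`, applied to powers of `g`,
  -- makes the stable lengths equal.
  have hspec : ∀ g ∈ H 0, MLS.stableLength o₁ g = MLS.stableLength o₂ g := by
    refine Nat.decreasingInduction' (m := 0) (n := n)
      (P := fun i => ∀ g ∈ H i, MLS.stableLength o₁ g = MLS.stableLength o₂ g)
      (fun i hi _ ih g hg => ?_) n.zero_le hl
    obtain ⟨C, hC⟩ := MLS.exists_abs_sub_dist_le (hext₁ (i + 1) hi) (hext₂ (i + 1) hi)
      (hconj i hi) ih
    exact MLS.stableLength_eq_of_abs_sub_le fun m => hC _ ((H i).pow_mem hg m)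
  obtain ⟨C, hC⟩ := MLS.exists_abs_sub_dist_le (K := ⊤) (hext₁ 0 n.zero_le) (hext₂ 0 n.zero_le)
    (fun _ _ _ _ => hH0 ▸ Subgroup.mem_top _) hspec
  refine ⟨C, fun g h => ?_⟩
  have e₁ : dist (g • o₁) (h • o₁) = dist o₁ ((g⁻¹ * h) • o₁) := by
    rw [← dist_smul g o₁, mul_smul, smul_inv_smul]
  have e₂ : dist (g • o₂) (h • o₂) = dist o₂ ((g⁻¹ * h) • o₂) := by
    rw [← dist_smul g o₂, mul_smul, smul_inv_smul]
  rw [e₁, e₂]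
  exact hC _ (Subgroup.mem_top _)
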